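/- Let $n$ be a natural number and let $M_n$ be the space of $n\times n$ complex matrices, with transpose map $t(X)=X^t$ and, for $C\in M_n$, the map $\Phi_C(X)=CXC^*$. Order $M_p(M_n)$ by identifying it with $M_{pn}$ through block matrices: an element of $M_p(M_n)$ is positive if the corresponding $pn\times pn$ matrix is positive semidefinite. A linear map $\Phi:M_n\to M_n$ is positive if it takes positive semidefinite matrices to positive semidefinite matrices, and completely positive if for every $p$ the map $(A_{ij})\mapsto(\Phi(A_{ij}))$ on $M_p(M_n)$ preserves positivity. It is an order isomorphism (respectively, a complete order isomorphism) if it is invertible and both $\Phi$ and $\Phi^{-1}$ are positive (respectively, completely positive), and it is a co-positive order isomorphism if $t\circ\Phi$ is a complete order isomorphism. Let $\Phi:M_n\to M_n$ be an order isomorphism. Then there exists an invertible $C\in M_n$ such that either (1) $\Phi=\Phi_C$ or (2) $\Phi=t\circ\Phi_C$. If $\Phi=\Phi_C$ for some invertible $C$, then $\Phi$ is a complete order isomorphism; if $\Phi=t\circ\Phi_C$ for some invertible $C$, then $\Phi$ is a co-positive order isomorphism. If $n>1$, the two cases cannot occur simultaneously: there are no invertible $C,D\in M_n$ with $\Phi=\Phi_C$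 and $\Phi=t\circ\Phi_D$. -/

import Mathlib

open scoped ComplexOrder

namespace MatrixOrdered

/-- The matrix ordering on `M_n(ℂ)`: a `p × p` matrix `A` over `M_n(ℂ)` belongs to
`M_p(M_n(ℂ))⁺` when the associated `pn × pn` block matrix, that is, the associated operator on
`ℂⁿ ⊕ ⋯ ⊕ ℂⁿ`, is positive semidefinite. -/
def IsPos {n p : ℕ} (A : Matrix (Fin p) (Fin p) (Matrix (Fin n) (Fin n) ℂ)) : Prop :=
  (Matrix.comp (Fin p) (Fin p) (Fin n) (Fin n) ℂ A).PosSemidef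

/-- A linear map is positive if it takes positive matrices to positive matrices. -/
def IsPositiveMap {n m : ℕ}
    (Φ : Matrix (Fin n) (Fin n) ℂ →ₗ[ℂ] Matrix (Fin m) (Fin m) ℂ) : Prop :=
  ∀ A : Matrix (Fin n) (Fin n) ℂ, A.PosSemidef → (Φ A).PosSemidef

/-- A linear map is completely positive if, for every `p`, applying it to all the entries of an
element of `M_p(M_n(ℂ))⁺` gives an element of `M_p(M_m(ℂ))⁺`. -/
def IsCompletelyPositive {n m : ℕ}
    (Φ : Matrix (Fin n) (Fin n) ℂ →ₗ[ℂ] Matrix (Fin m) (Fin m) ℂ) : Prop :=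
  ∀ (p : ℕ) (A : Matrix (Fin p) (Fin p) (Matrix (Fin n) (Fin n) ℂ)), IsPos A → IsPos (A.map Φ)

/-- A linear map is an order isomorphism if it is invertible and both it and its inverse are
positive. -/
def IsOrderIso {n m : ℕ}
    (Φ : Matrix (Fin n) (Fin n) ℂ →ₗ[ℂ] Matrix (Fin m) (Fin m) ℂ) : Prop :=
  ∃ e : Matrix (Fin n) (Fin n) ℂ ≃ₗ[ℂ] Matrix (Fin m) (Fin m) ℂ,
    e.toLinearMap = Φ ∧ IsPositiveMap e.toLinearMap ∧ IsPositiveMap e.symm.toLinearMap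

/-- A linear map is a complete order isomorphism if it is invertible and both it and its inverse
are completely positive. -/
def IsCompleteOrderIso {n m : ℕ}
    (Φ : Matrix (Fin n) (Fin n) ℂ →ₗ[ℂ] Matrix (Fin m) (Fin m) ℂ) : Prop :=
  ∃ e : Matrix (Fin n) (Fin n) ℂ ≃ₗ[ℂ] Matrix (Fin m) (Fin m) ℂ,
    e.toLinearMap = Φ ∧
      IsCompletelyPositive e.toLinearMap ∧ IsCompletelyPositive e.symm.toLinearMap

/-- The transpose map `t` on `M_n(ℂ)`. -/
def transposeMap (n : ℕ) : Matrix (Fin n) (Fin n) ℂ →ₗ[ℂ] Matrix (Fin n) (Fin n) ℂ :=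
  (Matrix.transposeLinearEquiv (Fin n) (Fin n) ℂ ℂ).toLinearMap

/-- A linear map `Φ` on `M_n(ℂ)` is a co-positive order isomorphism if `t ∘ Φ` is a complete order
isomorphism. -/
def IsCopositiveOrderIso {n : ℕ}
    (Φ : Matrix (Fin n) (Fin n) ℂ →ₗ[ℂ] Matrix (Fin n) (Fin n) ℂ) : Prop :=
  IsCompleteOrderIso (transposeMap n ∘ₗ Φ)

/-- The map `Φ_C : X ↦ C X C*`. -/
def conjMap {n : ℕ} (C : Matrix (Fin n) (Fin n) ℂ) :
    Matrix (Fin n) (Fin n) ℂ →ₗ[ℂ] Matrix (Fin n) (Fin n) ℂ where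
  toFun X := C * X * C.conjTranspose
  map_add' X Y := by rw [Matrix.mul_add, Matrix.add_mul]
  map_smul' c X := by rw [Matrix.mul_smul, Matrix.smul_mul, RingHom.id_apply]

end MatrixOrdered

namespace MatrixOrdered

open Matrix

/-! An order isomorphism preserves extreme rays of the positive cone, so it sends each `E_ii` to
some `c_i c_i*` (`exists_map_single_eq_vecMulVec`). The matrix with columns `c_i` is invertible, and
undoing its conjugation leaves a map fixing every `E_ii`.

Such a map preserves each block `c E_ij + c̄ E_ji` and acts there as a real-linear isometry of `ℂ`,
so as `c ↦ bc` or `c ↦ a c̄` with a unimodular coefficient (`exists_coeff`). Images of `vv*` with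
`v` unimodular have multiplicative entries, which forces the same alternative on all blocks
(`coeff_eq_zero_of_adjacent`). The first alternative everywhere is conjugation by a diagonal
unitary; the second becomes the first after a transpose.

The cases exclude each other for `n > 1` because a conjugation equal to the transpose would be
multiplicative. -/

theorem normSq_entry_le {n : ℕ} {A : Matrix (Fin n) (Fin n) ℂ} (hA : A.PosSemidef) (i j : Fin n) :
    Complex.normSq (A i j) ≤ (A i i).re * (A j j).re := by
  have h := (hA.submatrix ![i, j]).det_nonneg
  have hi : 0 ≤ A i i := hA.diag_nonneg
  have hj : 0 ≤ A j j := hA.diag_nonneg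
  have hij : A j i = star (A i j) := (hA.1.apply j i).symm
  rw [Matrix.det_fin_two] at h
  simp only [submatrix_apply, cons_val_zero, cons_val_one, hij] at h
  have h' := (Complex.le_def.1 h).1
  have h1 := (Complex.le_def.1 hi).2
  have h2 := (Complex.le_def.1 hj).2
  simp at h' h1 h2
  rw [← h1, ← h2] at h'
  rw [Complex.normSq_apply]
  linarith

theorem entry_eq_zero_of_diag {n : ℕ} {A : Matrix (Fin n) (Fin n) ℂ} (hA : A.PosSemidef)
    {i j : Fin n} (h : A i i = 0 ∨ A j j = 0) : A i j = 0 := by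
  have := normSq_entry_le hA i j
  refine Complex.normSq_eq_zero.1 (le_antisymm (this.trans ?_) (Complex.normSq_nonneg _))
  rcases h with h | h <;> simp [h]

/-- The matrix unit `E_ii` spans an extreme ray of the cone of positive matrices. -/
theorem eq_smul_single_of_le {n : ℕ} {B : Matrix (Fin n) (Fin n) ℂ} {i : Fin n}
    (hB : B.PosSemidef) (h : (single i i 1 - B).PosSemidef) : B = B i i • single i i 1 := by
  have hd : ∀ k, k ≠ i → B k k = 0 := fun k hk => by
    have h1 : 0 ≤ B k k := hB.diag_nonneg
    have h2 : 0 ≤ (single i i (1 : ℂ) - B) k k := h.diag_nonneg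
    rw [Matrix.sub_apply, single_apply_of_ne _ _ _ _ _ (fun h => hk h.1.symm)] at h2
    exact le_antisymm (by simpa using h2) h1
  ext k l
  by_cases hk : k = i
  · by_cases hl : l = i
    · subst hk hl; simp
    · rw [entry_eq_zero_of_diag hB (.inr (hd l hl))]
      simp [Ne.symm hl]
  · rw [entry_eq_zero_of_diag hB (.inl (hd k hk))]
    simp [Ne.symm hk]

/-- A positive matrix with unimodular entries and unit diagonal has rank one. -/
theorem entry_mul_entry_of_normSq_eq_one {n : ℕ} {H : Matrix (Fin n) (Fin n) ℂ}
    (hH : H.PosSemidef) (hd : ∀ i, H i i = 1) (hu : ∀ i j, Complex.normSq (H i j) = 1)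
    (i j k : Fin n) : H i j * H j k = H i k := by
  have hs : ∀ i j, H j i = star (H i j) := fun i j => (hH.1.apply j i).symm
  have hm : ∀ i j, H i j * H j i = 1 := fun i j => by
    rw [hs i j, Complex.star_def, Complex.mul_conj, hu]; simp
  -- The form of `H` vanishes at `e_k - H_jk e_j`, so by positivity `H` kills this vector;
  -- coordinate `i` of the result is the claim.
  have key : star (Pi.single j (-H j k) + Pi.single k 1 : Fin n → ℂ) ⬝ᵥ
      H *ᵥ (Pi.single j (-H j k) + Pi.single k 1) = 0 := by
    simp [mulVec_add, add_dotProduct, dotProduct_add, hd]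
    have h1 := hs j k
    have h2 := hm j k
    rw [Complex.star_def] at h1
    rw [← h1]
    linear_combination -h2
  have := congrFun ((hH.dotProduct_mulVec_zero_iff _).1 key) i
  simp [mulVec_add] at this
  linear_combination -this

/-! ### Conjugations and the transpose. -/

theorem isPos_map_conjMap {n p : ℕ} (C : Matrix (Fin n) (Fin n) ℂ)
    (A : Matrix (Fin p) (Fin p) (Matrix (Fin n) (Fin n) ℂ)) (hA : IsPos A) :
    IsPos (A.map (conjMap C)) := by
  -- Entrywise conjugation is congruence of the block matrix by `diag(C, …, C)`.
  have h : A.map (conjMap C) =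
      (diagonal fun _ => C) * A * (diagonal fun _ => Cᴴ) := by
    ext1 i j
    simp [conjMap]
  have h2 : Matrix.comp (Fin p) (Fin p) (Fin n) (Fin n) ℂ (diagonal fun _ => Cᴴ) =
      (Matrix.comp (Fin p) (Fin p) (Fin n) (Fin n) ℂ (diagonal fun _ => C))ᴴ := by
    ext ⟨i, k⟩ ⟨j, l⟩
    by_cases hij : i = j
    · subst hij; simp [comp_apply]
    · simp [comp_apply, hij, Ne.symm hij]
  have h3 := (compRingEquiv (Fin p) (Fin n) ℂ).map_mul ((diagonal fun _ => C) * A)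
    (diagonal fun _ => Cᴴ)
  rw [(compRingEquiv (Fin p) (Fin n) ℂ).map_mul (diagonal fun _ => C) A] at h3
  simp only [compRingEquiv_apply] at h3
  rw [IsPos, h, h3, h2]
  exact hA.mul_mul_conjTranspose_same _

@[simp] theorem conjMap_apply {n : ℕ} (C X : Matrix (Fin n) (Fin n) ℂ) :
    conjMap C X = C * X * Cᴴ := rfl

@[simp] theorem transposeMap_apply {n : ℕ} (X : Matrix (Fin n) (Fin n) ℂ) :
    transposeMap n X = Xᵀ := rfl

theorem isPositiveMap_conjMap {n : ℕ} (C : Matrix (Fin n) (Fin n) ℂ) :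
    IsPositiveMap (conjMap C) := fun _ hA => hA.mul_mul_conjTranspose_same C

theorem conjMap_comp {n : ℕ} (C D : Matrix (Fin n) (Fin n) ℂ) :
    conjMap C ∘ₗ conjMap D = conjMap (C * D) := by
  ext1 X
  simp [Matrix.mul_assoc]

theorem conjMap_one {n : ℕ} : conjMap (1 : Matrix (Fin n) (Fin n) ℂ) = LinearMap.id := by
  ext1 X
  simp

/-- Conjugation by an invertible matrix as a linear equivalence. -/
noncomputable def conjEquiv {n : ℕ} (C : (Matrix (Fin n) (Fin n) ℂ)ˣ) :
    Matrix (Fin n) (Fin n) ℂ ≃ₗ[ℂ] Matrix (Fin n) (Fin n) ℂ :=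
  LinearEquiv.ofLinearMap (conjMap C) (conjMap ↑C⁻¹)
    (by rw [conjMap_comp, Units.mul_inv, conjMap_one])
    (by rw [conjMap_comp, Units.inv_mul, conjMap_one])

theorem isCompleteOrderIso_conjMap {n : ℕ} (C : (Matrix (Fin n) (Fin n) ℂ)ˣ) :
    IsCompleteOrderIso (conjMap (C : Matrix (Fin n) (Fin n) ℂ)) :=
  ⟨conjEquiv C, rfl, fun _ _ => isPos_map_conjMap _ _, fun _ _ => isPos_map_conjMap _ _⟩

theorem transposeMap_comp_transposeMap_comp {n : ℕ}
    (Φ : Matrix (Fin n) (Fin n) ℂ →ₗ[ℂ] Matrix (Fin n) (Fin n) ℂ) :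
    transposeMap n ∘ₗ transposeMap n ∘ₗ Φ = Φ := by
  ext1 X
  simp

theorem conjMap_comp_transposeMap {n : ℕ} (C : Matrix (Fin n) (Fin n) ℂ) :
    conjMap C ∘ₗ transposeMap n = transposeMap n ∘ₗ conjMap ((starRingEnd ℂ).mapMatrix C) := by
  ext1 X
  have h : ((starRingEnd ℂ).mapMatrix C)ᵀ = Cᴴ := rfl
  have h2 : (((starRingEnd ℂ).mapMatrix C)ᴴ)ᵀ = C := by ext i j; simp
  simp only [LinearMap.comp_apply, conjMap_apply, transposeMap_apply, transpose_mul, h, h2,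
    Matrix.mul_assoc]

/-- Evaluating at `1` makes `G` unitary, so conjugation by it preserves products, while the
transpose reverses them; `E_ab E_ba` tells the two apart. -/
theorem conjMap_ne_transposeMap {n : ℕ} (hn : 1 < n) (G : Matrix (Fin n) (Fin n) ℂ) :
    conjMap G ≠ transposeMap n := by
  intro h
  have h0 : ∀ X, G * X * Gᴴ = Xᵀ := fun X => LinearMap.congr_fun h X
  have h1 : G * Gᴴ = 1 := by simpa using h0 1
  have h2 : Gᴴ * G = 1 := mul_eq_one_comm.1 h1
  have h3 : ∀ X Y : Matrix (Fin n) (Fin n) ℂ, (X * Y)ᵀ = Xᵀ * Yᵀ := fun X Y => by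
    rw [← h0, ← h0, ← h0]
    calc G * (X * Y) * Gᴴ = G * X * 1 * Y * Gᴴ := by simp only [Matrix.mul_assoc, Matrix.one_mul]
      _ = _ := by rw [← h2]; simp only [Matrix.mul_assoc]
  let a : Fin n := ⟨0, by omega⟩
  let b : Fin n := ⟨1, hn⟩
  have hab : b ≠ a := by simp [a, b]
  have := congrFun₂ (h3 (single a b 1) (single b a 1)) a a
  simp [hab] at this

theorem conjMap_ne_transposeMap_comp_conjMap {n : ℕ} (hn : 1 < n)
    (C : Matrix (Fin n) (Fin n) ℂ) (D : (Matrix (Fin n) (Fin n) ℂ)ˣ) :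
    conjMap C ≠ transposeMap n ∘ₗ conjMap (D : Matrix (Fin n) (Fin n) ℂ) := by
  intro h
  refine conjMap_ne_transposeMap hn (C * (↑D⁻¹ : Matrix (Fin n) (Fin n) ℂ)) ?_
  rw [← conjMap_comp, h, LinearMap.comp_assoc, conjMap_comp, Units.mul_inv, conjMap_one,
    LinearMap.comp_id]

/-! ### Positive maps fixing the diagonal units: one off-diagonal block. -/

/-- The Hermitian matrix `c E_ij + c̄ E_ji`. -/
def hermitianUnit {n : ℕ} (i j : Fin n) (c : ℂ) : Matrix (Fin n) (Fin n) ℂ :=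
  single i j c + single j i (star c)

theorem hermitianUnit_swap {n : ℕ} (i j : Fin n) (c : ℂ) :
    hermitianUnit j i (star c) = hermitianUnit i j c := by
  simp [hermitianUnit, add_comm]

theorem hermitianUnit_neg {n : ℕ} (i j : Fin n) (c : ℂ) :
    hermitianUnit i j (-c) = -hermitianUnit i j c := by
  ext k l
  simp [hermitianUnit, single_apply, add_comm]
  split_ifs <;> simp

theorem vecMulVec_pi_single {n : ℕ} (i j : Fin n) (a b : ℂ) :
    vecMulVec (Pi.single i a) (Pi.single j b) = single i j (a * b) := by
  ext k l
  simp only [vecMulVec_apply, Pi.single_apply, single_apply]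
  by_cases hk : i = k <;> by_cases hl : j = l <;> simp [hk, hl, eq_comm (a := k), eq_comm (a := l)]

/-- This is `vv*` for `v = √ε e_i + (c̄/√ε) e_j`. The free `ε` makes the `i`-th diagonal weight
arbitrarily small. -/
theorem posSemidef_add_hermitianUnit {n : ℕ} {i j : Fin n} (c : ℂ) {ε : ℝ} (hε : 0 < ε) :
    (single i i (ε : ℂ) + single j j ((Complex.normSq c / ε : ℝ) : ℂ) +
      hermitianUnit i j c).PosSemidef := by
  have h := posSemidef_vecMulVec_self_star
    (Pi.single i ((√ε : ℝ) : ℂ) + Pi.single j (star c / ((√ε : ℝ) : ℂ)) : Fin n → ℂ)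
  convert h using 1
  have h0 : ((√ε : ℝ) : ℂ) ≠ 0 := by
    exact_mod_cast (Real.sqrt_pos.2 hε).ne'
  have h1 : ((√ε : ℝ) : ℂ) * ((√ε : ℝ) : ℂ) = ε := by
    exact_mod_cast Real.mul_self_sqrt hε.le
  have h2 : star c / ((√ε : ℝ) : ℂ) * (c / ((√ε : ℝ) : ℂ)) =
      ((Complex.normSq c / ε : ℝ) : ℂ) := by
    rw [div_mul_div_comm, h1, mul_comm, Complex.star_def, Complex.mul_conj]
    push_cast
    rfl
  rw [star_add, add_vecMulVec, vecMulVec_add, vecMulVec_add]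
  simp only [← Pi.single_star, vecMulVec_pi_single, star_div₀, star_star]
  rw [Complex.star_def, Complex.conj_ofReal, ← Complex.star_def, h2, h1, mul_div_cancel₀ _ h0, div_mul_cancel₀ _ h0, hermitianUnit]
  abel

section FixedDiagonal

variable {n : ℕ} {Ψ : Matrix (Fin n) (Fin n) ℂ →ₗ[ℂ] Matrix (Fin n) (Fin n) ℂ}

theorem map_single_diag (hfix : ∀ i, Ψ (single i i 1) = single i i 1) (i : Fin n) (x : ℂ) :
    Ψ (single i i x) = single i i x := by
  have := congrArg (fun Y => x • Y) (hfix i)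
  simpa only [← map_smul, smul_single, smul_eq_mul, mul_one] using this

theorem posSemidef_add_map_hermitianUnit (hΨ : IsPositiveMap Ψ)
    (hfix : ∀ i, Ψ (single i i 1) = single i i 1) (i j : Fin n) (c : ℂ) {ε : ℝ} (hε : 0 < ε) :
    (single i i (ε : ℂ) + single j j ((Complex.normSq c / ε : ℝ) : ℂ) +
      Ψ (hermitianUnit i j c)).PosSemidef := by
  have := hΨ _ (posSemidef_add_hermitianUnit (i := i) (j := j) c hε)
  rwa [map_add, map_add, map_single_diag hfix, map_single_diag hfix] at this

theorem posSemidef_sub_map_hermitianUnit (hΨ : IsPositiveMap Ψ)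
    (hfix : ∀ i, Ψ (single i i 1) = single i i 1) (i j : Fin n) (c : ℂ) {ε : ℝ} (hε : 0 < ε) :
    (single i i (ε : ℂ) + single j j ((Complex.normSq c / ε : ℝ) : ℂ) -
      Ψ (hermitianUnit i j c)).PosSemidef := by
  have := posSemidef_add_map_hermitianUnit hΨ hfix i j (-c) hε
  rwa [hermitianUnit_neg, LinearMap.map_neg, ← sub_eq_add_neg, Complex.normSq_neg] at this

/-- Both signs of `c` are available, so the entry lies between `-ε` and `ε` for every `ε > 0`. -/
theorem map_hermitianUnit_diag_left (hΨ : IsPositiveMap Ψ)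
    (hfix : ∀ i, Ψ (single i i 1) = single i i 1) {i j : Fin n} (hij : i ≠ j) (c : ℂ) :
    Ψ (hermitianUnit i j c) i i = 0 := by
  have h1 : ∀ ε : ℝ, 0 < ε → 0 ≤ (ε : ℂ) + Ψ (hermitianUnit i j c) i i := fun ε hε => by
    have : 0 ≤ (single i i (ε : ℂ) + _ + _ : Matrix (Fin n) (Fin n) ℂ) i i :=
      (posSemidef_add_map_hermitianUnit hΨ hfix i j c hε).diag_nonneg
    simpa [hij.symm] using this
  have h2 : ∀ ε : ℝ, 0 < ε → 0 ≤ (ε : ℂ) - Ψ (hermitianUnit i j c) i i := fun ε hε => by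
    have : 0 ≤ (single i i (ε : ℂ) + _ - _ : Matrix (Fin n) (Fin n) ℂ) i i :=
      (posSemidef_sub_map_hermitianUnit hΨ hfix i j c hε).diag_nonneg
    simpa [hij.symm] using this
  apply Complex.ext
  · apply le_antisymm
    · refine le_of_forall_pos_le_add fun ε hε => ?_
      have := (Complex.le_def.1 (h2 ε hε)).1
      simp at this ⊢
      exact this
    · refine le_of_forall_pos_le_add fun ε hε => ?_
      have := (Complex.le_def.1 (h1 ε hε)).1
      simp at this ⊢
      linarith
  · have := (Complex.le_def.1 (h1 1 one_pos)).2
    simpa using this.symm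

theorem map_hermitianUnit_apply_eq_zero_of_ne (hΨ : IsPositiveMap Ψ)
    (hfix : ∀ i, Ψ (single i i 1) = single i i 1) {i j : Fin n} (c : ℂ)
    {k : Fin n} (hi : k ≠ i) (hj : k ≠ j) (l : Fin n) :
    Ψ (hermitianUnit i j c) k l = 0 ∧ Ψ (hermitianUnit i j c) l k = 0 := by
  have hp := posSemidef_add_map_hermitianUnit hΨ hfix i j c one_pos
  have hm := posSemidef_sub_map_hermitianUnit hΨ hfix i j c one_pos
  have h1 := hp.diag_nonneg (i := k)
  have h2 := hm.diag_nonneg (i := k)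
  have e1 : ∀ l x, (single i i x : Matrix (Fin n) (Fin n) ℂ) k l = 0 := fun l x => by
    simp [hi.symm]
  have e2 : ∀ l x, (single j j x : Matrix (Fin n) (Fin n) ℂ) k l = 0 := fun l x => by
    simp [hj.symm]
  have e3 : ∀ l x, (single i i x : Matrix (Fin n) (Fin n) ℂ) l k = 0 := fun l x => by
    simp [hi.symm]
  have e4 : ∀ l x, (single j j x : Matrix (Fin n) (Fin n) ℂ) l k = 0 := fun l x => by
    simp [hj.symm]
  simp only [Matrix.sub_apply, Matrix.add_apply, e1, e2, zero_add, zero_sub] at h1 h2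
  have h0 : Ψ (hermitianUnit i j c) k k = 0 := le_antisymm (by simpa using h2) h1
  constructor
  · have := entry_eq_zero_of_diag hp (i := k) (j := l)
      (.inl (by simp only [Matrix.add_apply, e1, e2, h0, zero_add]))
    simpa only [Matrix.add_apply, e1, e2, zero_add] using this
  · have := entry_eq_zero_of_diag hp (i := l) (j := k)
      (.inr (by simp only [Matrix.add_apply, e1, e2, h0, zero_add]))
    simpa only [Matrix.add_apply, e3, e4, zero_add] using this

/-- A positive map fixing the diagonal matrix units preserves each off-diagonal Hermitian block
and is contractive there. -/
theorem map_hermitianUnit (hΨ : IsPositiveMap Ψ)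
    (hfix : ∀ i, Ψ (single i i 1) = single i i 1) {i j : Fin n} (hij : i ≠ j) (c : ℂ) :
    ∃ h : ℂ, Ψ (hermitianUnit i j c) = hermitianUnit i j h ∧
      Complex.normSq h ≤ Complex.normSq c := by
  have hp := posSemidef_add_map_hermitianUnit hΨ hfix i j c one_pos
  have hi := map_hermitianUnit_diag_left hΨ hfix hij c
  have hj := map_hermitianUnit_diag_left hΨ hfix hij.symm (star c)
  rw [hermitianUnit_swap] at hj
  have hz := fun k hi hj l =>
    map_hermitianUnit_apply_eq_zero_of_ne hΨ hfix c (i := i) (j := j) (k := k) hi hj l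
  have hh := hp.1.apply j i
  -- With `ε = 1` the diagonal entries at `i` and `j` are `1` and `|c|²`, so this minor gives the
  -- contraction.
  have hn := normSq_entry_le hp i j
  simp [hij, hij.symm, hi, hj] at hn hh
  generalize Ψ (hermitianUnit i j c) = H at *
  refine ⟨H i j, ?_, hn⟩
  ext k l
  by_cases hk : k ≠ i ∧ k ≠ j
  · rw [(hz k hk.1 hk.2 l).1]
    simp [hermitianUnit, hk.1.symm, hk.2.symm]
  by_cases hl : l ≠ i ∧ l ≠ j
  · rw [(hz l hl.1 hl.2 k).2]
    simp [hermitianUnit, hl.1.symm, hl.2.symm]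
  have hk' : k = i ∨ k = j := by tauto
  have hl' : l = i ∨ l = j := by tauto
  rcases hk' with rfl | rfl <;> rcases hl' with rfl | rfl <;>
    simp [hermitianUnit, hi, hj, hij, hij.symm, hh]

end FixedDiagonal

/-- An order automorphism fixing the diagonal matrix units. -/
structure IsDiagonalFixing {n : ℕ}
    (e : Matrix (Fin n) (Fin n) ℂ ≃ₗ[ℂ] Matrix (Fin n) (Fin n) ℂ) : Prop where
  pos : IsPositiveMap e.toLinearMap
  symm_pos : IsPositiveMap e.symm.toLinearMap
  fix : ∀ i, e (single i i 1) = single i i 1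

namespace IsDiagonalFixing

variable {n : ℕ} {e : Matrix (Fin n) (Fin n) ℂ ≃ₗ[ℂ] Matrix (Fin n) (Fin n) ℂ}

/-- The inverse is contractive on the block too. -/
theorem map_hermitianUnit (he : IsDiagonalFixing e) {i j : Fin n} (hij : i ≠ j) (c : ℂ) :
    ∃ h : ℂ, e (hermitianUnit i j c) = hermitianUnit i j h ∧
      Complex.normSq h = Complex.normSq c := by
  obtain ⟨h, h1, h2⟩ := MatrixOrdered.map_hermitianUnit he.pos he.fix hij c
  obtain ⟨c', h3, h4⟩ := MatrixOrdered.map_hermitianUnit he.symm_pos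
    (fun i => e.symm_apply_eq.2 (he.fix i).symm) hij h
  refine ⟨h, h1, le_antisymm h2 ?_⟩
  have h5 : hermitianUnit i j c = hermitianUnit i j c' := by
    rw [← h3, ← h1]; exact (e.symm_apply_apply _).symm
  have := congrFun₂ h5 i j
  simp [hermitianUnit, hij.symm] at this
  rwa [this]

/-- The action on an off-diagonal block, in coordinates. -/
theorem exists_coeff (he : IsDiagonalFixing e) {i j : Fin n} (hij : i ≠ j) :
    ∃ b a : ℂ, (∀ x y, e (single i j x + single j i y) =
      single i j (b * x + a * y) + single j i (star a * x + star b * y)) ∧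
      ((a = 0 ∧ Complex.normSq b = 1) ∨ (b = 0 ∧ Complex.normSq a = 1)) := by
  obtain ⟨h, h1, -⟩ := he.map_hermitianUnit hij 1
  obtain ⟨g, h2, -⟩ := he.map_hermitianUnit hij Complex.I
  have key : ∀ x y, e (single i j x + single j i y) =
      single i j ((h - Complex.I * g) / 2 * x + (h + Complex.I * g) / 2 * y) +
      single j i (star ((h + Complex.I * g) / 2) * x + star ((h - Complex.I * g) / 2) * y) := by
    intro x y
    have h3 : single i j x + single j i y =
        ((x + y) / 2) • hermitianUnit i j 1 +
          (Complex.I * (y - x) / 2) • hermitianUnit i j Complex.I := by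
      simp only [hermitianUnit, smul_add, smul_single, smul_eq_mul, star_one]
      rw [add_add_add_comm, ← single_add, ← single_add]
      congr 2
      · linear_combination (-(y-x) / 2) * Complex.I_mul_I
      · simp only [Complex.star_def, Complex.conj_I]
        linear_combination ((y-x) / 2) * Complex.I_mul_I
    rw [h3, map_add, map_smul, map_smul, h1, h2]
    simp only [hermitianUnit, smul_add, smul_single, smul_eq_mul]
    rw [add_add_add_comm, ← single_add, ← single_add]
    congr 2
    · ring
    · simp only [Complex.star_def, map_div₀, map_add, map_sub, map_mul, Complex.conj_I,
        Complex.conj_ofNat]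
      ring
  refine ⟨_, _, key, ?_⟩
  generalize (h - Complex.I * g) / 2 = b at *
  generalize (h + Complex.I * g) / 2 = a at *
  have hc : ∀ c : ℂ, Complex.normSq (b * c + a * star c) = Complex.normSq c := fun c => by
    obtain ⟨f, hf, hf'⟩ := he.map_hermitianUnit hij c
    have := congrFun₂ ((key c (star c)).symm.trans hf) i j
    simp [hermitianUnit, hij.symm] at this
    rw [← hf', ← this, Complex.star_def]
  -- The cross term of `|bc + a c̄|²` is `2 Re(ā b c²)`: `c = 1, i` kill the real part of `ā b`, and
  -- `c = 1 ± i` the imaginary part.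
  have c1 := hc 1
  have c2 := hc Complex.I
  have c3 := hc (1 + Complex.I)
  have c4 := hc (1 - Complex.I)
  have h0 : a = 0 ∨ b = 0 := by
    have : star a * b = 0 := by
      apply Complex.ext <;> simp [Complex.normSq_apply] at * <;> linarith
    simpa using this
  rcases h0 with rfl | rfl
  · left; simpa using c1
  · right; simpa using c1

end IsDiagonalFixing

/-! ### Gluing the blocks. -/

namespace IsDiagonalFixing

variable {n : ℕ} {e : Matrix (Fin n) (Fin n) ℂ ≃ₗ[ℂ] Matrix (Fin n) (Fin n) ℂ}

theorem exists_entry_formula (he : IsDiagonalFixing e) :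
    ∃ b a : Fin n → Fin n → ℂ, (∀ X i, e X i i = X i i) ∧
      (∀ X i j, i ≠ j → e X i j = b i j * X i j + a i j * X j i) ∧
      ∀ i j, i ≠ j → (a i j = 0 ∧ Complex.normSq (b i j) = 1) ∨
        (b i j = 0 ∧ Complex.normSq (a i j) = 1) := by
  have hex : ∀ i j : Fin n, ∃ b a : ℂ, i ≠ j → (∀ x y, e (single i j x + single j i y) =
      single i j (b * x + a * y) + single j i (star a * x + star b * y)) ∧
      ((a = 0 ∧ Complex.normSq b = 1) ∨ (b = 0 ∧ Complex.normSq a = 1)) := fun i j => by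
    by_cases hij : i = j
    · exact ⟨0, 0, fun h => absurd hij h⟩
    · obtain ⟨b, a, h⟩ := he.exists_coeff hij
      exact ⟨b, a, fun _ => h⟩
  choose b a hba using hex
  have hdiag : ∀ i x, e (single i i x) = single i i x :=
    map_single_diag (Ψ := e.toLinearMap) he.fix
  have h1 : ∀ i j, i ≠ j → ∀ x, e (single i j x) =
      single i j (b i j * x) + single j i (star (a i j) * x) := fun i j hij x => by
    simpa using (hba i j hij).1 x 0
  have h2 : ∀ i j, i ≠ j → ∀ x, e (single j i x) =
      single i j (a i j * x) + single j i (star (b i j) * x) := fun i j hij x => by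
    simpa using (hba i j hij).1 0 x
  refine ⟨b, a, fun X i => ?_, fun X i j hij => ?_, fun i j hij => (hba i j hij).2⟩
  · induction X using Matrix.induction_on' with
    | h_zero => simp
    | h_add p q hp hq => simp [hp, hq]
    | h_std_basis k l x =>
      by_cases hkl : k = l
      · subst hkl; rw [hdiag]
      · rw [h1 k l hkl]
        have h3 : ¬(k = i ∧ l = i) := fun h => hkl (h.1.trans h.2.symm)
        have h4 : ¬(l = i ∧ k = i) := fun h => hkl (h.2.trans h.1.symm)
        simp [h3, h4]
  · induction X using Matrix.induction_on' with
    | h_zero => simp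
    | h_add p q hp hq => simp [hp, hq]; ring
    | h_std_basis k l x =>
      by_cases hkl : k = l
      · subst hkl
        have h3 : ¬(k = i ∧ k = j) := fun h => hij (h.1.symm.trans h.2)
        have h4 : ¬(k = j ∧ k = i) := fun h => hij (h.2.symm.trans h.1)
        rw [hdiag]
        simp [h3, h4]
      · by_cases h3 : k = i ∧ l = j
        · obtain ⟨rfl, rfl⟩ := h3
          rw [h1 _ _ hij]
          simp [hij.symm, hij]
        · by_cases h4 : k = j ∧ l = i
          · obtain ⟨rfl, rfl⟩ := h4
            rw [h2 _ _ hij]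
            simp [hij.symm, hij]
          · have h5 : ¬(l = i ∧ k = j) := fun h => h4 h.symm
            rw [h1 k l hkl]
            simp [h3, h4, h5]

/-- The image of a rank-one projection onto a unimodular vector has multiplicative entries. -/
theorem entry_mul_entry (he : IsDiagonalFixing e) {b a : Fin n → Fin n → ℂ}
    (hd : ∀ X i, e X i i = X i i)
    (ho : ∀ X i j, i ≠ j → e X i j = b i j * X i j + a i j * X j i)
    (hab : ∀ i j, i ≠ j → (a i j = 0 ∧ Complex.normSq (b i j) = 1) ∨
        (b i j = 0 ∧ Complex.normSq (a i j) = 1))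
    (v : Fin n → ℂ) (hv : ∀ i, Complex.normSq (v i) = 1) (i j k : Fin n) :
    e (vecMulVec v (star v)) i j * e (vecMulVec v (star v)) j k =
      e (vecMulVec v (star v)) i k := by
  have hdiag : ∀ i, e (vecMulVec v (star v)) i i = 1 := fun i => by
    rw [hd, vecMulVec_apply, Pi.star_apply, Complex.star_def, Complex.mul_conj, hv]
    simp
  refine entry_mul_entry_of_normSq_eq_one (he.pos _ (posSemidef_vecMulVec_self_star v))
    hdiag (fun i j => ?_) i j k
  by_cases hij : i = j
  · subst hij
    simp [hdiag]
  · have := ho (vecMulVec v (star v)) i j hij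
    simp only [LinearEquiv.coe_coe, this]
    rcases hab i j hij with ⟨h1, h2⟩ | ⟨h1, h2⟩ <;> simp [h1, h2, hv, vecMulVec_apply]

/-- If `b` acts at `(i, j)` and `a` at `(j, k)`, the product of the two entries of the image of
`vv*` carries `v̄_j²`, while the `(i, k)` entry does not change with the unimodular `v_j`. Taking
`v_j = 1` and `v_j = i` gives opposite signs. -/
theorem coeff_eq_zero_of_adjacent (he : IsDiagonalFixing e) {b a : Fin n → Fin n → ℂ}
    (hd : ∀ X i, e X i i = X i i)
    (ho : ∀ X i j, i ≠ j → e X i j = b i j * X i j + a i j * X j i)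
    (hab : ∀ i j, i ≠ j → (a i j = 0 ∧ Complex.normSq (b i j) = 1) ∨
        (b i j = 0 ∧ Complex.normSq (a i j) = 1))
    {i j k : Fin n} (hij : i ≠ j) (hjk : j ≠ k) (h : a i j = 0) : a j k = 0 := by
  by_contra hne
  have hb : b i j ≠ 0 := by
    rcases hab i j hij with ⟨-, h2⟩ | ⟨-, h2⟩
    · intro h0; simp [h0] at h2
    · simp [h] at h2
  have hb0 : b j k = 0 := by
    rcases hab j k hjk with ⟨h1, -⟩ | ⟨h1, -⟩
    · exact absurd h1 hne
    · exact h1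
  have e1 := he.entry_mul_entry hd ho hab 1 (by simp) i j k
  have e2 := he.entry_mul_entry hd ho hab (Function.update 1 j Complex.I) (fun l => by
    by_cases hl : l = j <;> simp [hl]) i j k
  rw [ho _ _ _ hij, ho _ _ _ hjk] at e1 e2
  by_cases hik : i = k
  · subst hik
    rw [hd] at e1 e2
    simp [vecMulVec_apply, hij, h, hb0] at e1 e2
    have : (2 : ℂ) * (b i j * a j i) = 0 := by
      linear_combination e1 - e2 + (b i j * a j i) * Complex.I_mul_I
    simp_all
  · rw [ho _ _ _ hik] at e1 e2
    simp [vecMulVec_apply, hij, hjk.symm, h, hb0] at e1 e2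
    have : (2 : ℂ) * (b i j * a j k) = 0 := by
      linear_combination e1 - e2 + (b i j * a j k) * Complex.I_mul_I
    simp_all

/-- Here `e` is the entrywise product with `H`, the image of the all-ones matrix, and `H_ij = H_io
H_oj` with `H_oj` the conjugate of `H_jo`. -/
theorem exists_conjMap_of_coeff_eq_zero (he : IsDiagonalFixing e) {b a : Fin n → Fin n → ℂ}
    (hd : ∀ X i, e X i i = X i i)
    (ho : ∀ X i j, i ≠ j → e X i j = b i j * X i j + a i j * X j i)
    (hab : ∀ i j, i ≠ j → (a i j = 0 ∧ Complex.normSq (b i j) = 1) ∨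
        (b i j = 0 ∧ Complex.normSq (a i j) = 1))
    (ha : ∀ i j, i ≠ j → a i j = 0) :
    ∃ D : Matrix (Fin n) (Fin n) ℂ, IsUnit D ∧ e.toLinearMap = conjMap D := by
  rcases Nat.eq_zero_or_pos n with rfl | hn
  · exact ⟨1, isUnit_one, Subsingleton.elim _ _⟩
  let o : Fin n := ⟨0, hn⟩
  set H := e (vecMulVec 1 (star 1)) with hH
  have hmul : ∀ i j k, H i j * H j k = H i k := he.entry_mul_entry hd ho hab 1 (by simp)
  have h1 : ∀ i, H i i = 1 := fun i => by rw [hH, hd]; simp [vecMulVec_apply]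
  have hs : ∀ i j, star (H j i) = H i j := fun i j =>
    (he.pos _ (posSemidef_vecMulVec_self_star 1)).1.apply i j
  refine ⟨diagonal fun i => H i o, ?_, ?_⟩
  · rw [Matrix.isUnit_diagonal, Pi.isUnit_iff]
    exact fun i => IsUnit.of_mul_eq_one (H o i) (by rw [hmul, h1])
  · ext X i j
    simp only [conjMap_apply, diagonal_conjTranspose, mul_diagonal, diagonal_mul, Pi.star_apply,
      hs, LinearEquiv.coe_coe]
    have h2 : e X i j = H i j * X i j := by
      by_cases hij : i = j
      · subst hij; rw [hd, h1, one_mul]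
      · rw [hH, ho _ _ _ hij, ho _ _ _ hij, ha _ _ hij]
        simp [vecMulVec_apply]
    rw [h2, ← hmul i o j]
    ring

theorem trans_transpose (he : IsDiagonalFixing e) :
    IsDiagonalFixing (e.trans (transposeLinearEquiv (Fin n) (Fin n) ℂ ℂ)) where
  pos A hA := (he.pos A hA).transpose
  symm_pos A hA := he.symm_pos _ hA.transpose
  fix i := by simp [he.fix i]

theorem eq_conjMap_or (he : IsDiagonalFixing e) :
    ∃ D : Matrix (Fin n) (Fin n) ℂ, IsUnit D ∧
      (e.toLinearMap = conjMap D ∨ e.toLinearMap = transposeMap n ∘ₗ conjMap D) := by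
  obtain ⟨b, a, hd, ho, hab⟩ := he.exists_entry_formula
  by_cases hall : ∀ i j, i ≠ j → a i j = 0
  · obtain ⟨D, hD, h⟩ := he.exists_conjMap_of_coeff_eq_zero hd ho hab hall
    exact ⟨D, hD, .inl h⟩
  · push Not at hall
    obtain ⟨p, q, hpq, hne⟩ := hall
    have step : ∀ {i j k : Fin n}, i ≠ j → j ≠ k → a i j = 0 → a j k = 0 :=
      fun h1 h2 h3 => he.coeff_eq_zero_of_adjacent hd ho hab h1 h2 h3
    -- A zero of `a` at `(i, j)` would spread through `(j, p)` to `(p, q)`.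
    have hb : ∀ i j, i ≠ j → b i j = 0 := fun i j hij => by
      rcases hab i j hij with ⟨h, -⟩ | ⟨h, -⟩
      · exfalso
        by_cases hjp : j = p
        · subst hjp
          exact hne (step hij hpq h)
        · exact hne (step hjp hpq (step hij hjp h))
      · exact h
    obtain ⟨D, hD, h⟩ := he.trans_transpose.exists_conjMap_of_coeff_eq_zero
      (b := fun i j => a j i) (a := fun i j => b j i) (fun X i => hd X i)
      (fun X i j hij => (ho X j i hij.symm).trans (add_comm _ _))
      (fun i j hij => (hab j i hij.symm).symm) (fun i j hij => hb j i hij.symm)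
    refine ⟨D, hD, .inr ?_⟩
    rw [← h]
    exact (transposeMap_comp_transposeMap_comp _).symm

end IsDiagonalFixing

/-! ### Reduction to fixed diagonal units. -/

open scoped MatrixOrder Matrix.Norms.L2Operator in
theorem exists_posSemidef_smul_one_sub {n : ℕ} {Y : Matrix (Fin n) (Fin n) ℂ}
    (hY : Y.PosSemidef) : ∃ K : ℂ, (K • (1 : Matrix (Fin n) (Fin n) ℂ) - Y).PosSemidef := by
  have h := IsSelfAdjoint.le_algebraMap_norm_self (a := Y) hY.1
  refine ⟨(‖Y‖ : ℂ), ?_⟩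
  rw [Algebra.algebraMap_eq_smul_one] at h
  exact Matrix.le_iff.1 h

section

variable {n : ℕ} {e : Matrix (Fin n) (Fin n) ℂ ≃ₗ[ℂ] Matrix (Fin n) (Fin n) ℂ}

/-- The inverse pulls a nonzero rank-one summand `P` of `e(E_ii)` back below `E_ii`, hence onto its
ray, so `P` is a positive multiple of `e(E_ii)`. -/
theorem exists_map_single_eq_vecMulVec (h1 : IsPositiveMap e.toLinearMap)
    (h2 : IsPositiveMap e.symm.toLinearMap) (i : Fin n) :
    ∃ c : Fin n → ℂ, e (single i i 1) = vecMulVec c (star c) := by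
  have hE : (single i i (1 : ℂ)).PosSemidef := by
    have := posSemidef_vecMulVec_self_star (Pi.single i (1 : ℂ))
    rwa [← Pi.single_star, vecMulVec_pi_single, star_one, mul_one] at this
  obtain ⟨m, v, hv⟩ := posSemidef_iff_eq_sum_vecMulVec.1 (h1 _ hE)
  simp only [LinearEquiv.coe_coe] at hv
  obtain ⟨j, hj⟩ : ∃ j, vecMulVec (v j) (star (v j)) ≠ 0 := by
    by_contra! hall
    rw [Finset.sum_eq_zero fun j _ => hall j, LinearEquiv.map_eq_zero_iff] at hv
    simpa using congrFun₂ hv i i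
  set P := vecMulVec (v j) (star (v j)) with hP
  have hsub : (e (single i i 1) - P).PosSemidef := by
    rw [hv, ← Finset.add_sum_erase _ _ (Finset.mem_univ j), add_sub_cancel_left]
    exact posSemidef_sum _ fun k _ => posSemidef_vecMulVec_self_star _
  have hY : (e.symm P).PosSemidef := h2 _ (posSemidef_vecMulVec_self_star _)
  have hY' : (single i i 1 - e.symm P).PosSemidef := by
    have := h2 _ hsub
    simpa using this
  have h3 := congrArg e (eq_smul_single_of_le hY hY')
  have ht : 0 ≤ e.symm P i i := hY.diag_nonneg
  rw [map_smul, e.apply_symm_apply] at h3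
  obtain ⟨t, ht0, ht'⟩ : ∃ t : ℝ, 0 ≤ t ∧ (t : ℂ) = e.symm P i i :=
    ⟨_, (Complex.le_def.1 ht).1, Complex.ext rfl (Complex.le_def.1 ht).2⟩
  rw [← ht'] at h3
  have hne : t ≠ 0 := by
    rintro rfl
    exact hj (by simpa using h3)
  have hs : ((√t⁻¹ : ℝ) : ℂ) * ((√t⁻¹ : ℝ) : ℂ) = (t : ℂ)⁻¹ := by
    exact_mod_cast Real.mul_self_sqrt (inv_nonneg.2 ht0)
  refine ⟨((√t⁻¹ : ℝ) : ℂ) • v j, ?_⟩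
  rw [star_smul, smul_vecMulVec, vecMulVec_smul, smul_smul, Complex.star_def,
    Complex.conj_ofReal, hs, ← hP, h3, smul_smul, inv_mul_cancel₀ (by exact_mod_cast hne), one_smul]

theorem exists_conjMap_single (h1 : IsPositiveMap e.toLinearMap)
    (h2 : IsPositiveMap e.symm.toLinearMap) :
    ∃ C : (Matrix (Fin n) (Fin n) ℂ)ˣ, ∀ i, e (single i i 1) = conjMap (C : Matrix _ _ ℂ)
      (single i i 1) := by
  choose c hc using exists_map_single_eq_vecMulVec h1 h2
  let C : Matrix (Fin n) (Fin n) ℂ := of fun k i => c i k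
  have hC : ∀ i, e (single i i 1) = conjMap C (single i i 1) := fun i => by
    rw [hc]
    ext k l
    simp [C, vecMulVec_apply, Matrix.mul_apply, single_apply, Finset.sum_ite_eq, ite_and]
  have hsum : ∑ i, single i i (1 : ℂ) = (1 : Matrix (Fin n) (Fin n) ℂ) := by
    ext k l
    simp [Matrix.sum_apply, single_apply, Matrix.one_apply, ite_and]
  have h4 : e 1 = C * Cᴴ := by
    rw [← hsum, map_sum, Finset.sum_congr rfl fun i _ => hC i, ← map_sum, hsum]
    simp
  -- Since `1` is an order unit, `xx* ≤ K e(1) = K C C*` for some `K`. If `C* x = 0`, pairing with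
  -- `x` gives `(x* x)² ≤ 0`.
  have hinj : Function.Injective Cᴴ.mulVec := by
    rw [← Matrix.coe_mulVecLin, ← LinearMap.ker_eq_bot, LinearMap.ker_eq_bot']
    intro x hx
    rw [mulVecLin_apply] at hx
    obtain ⟨K, hK⟩ := exists_posSemidef_smul_one_sub (h2 _ (posSemidef_vecMulVec_self_star x))
    have h5 := (h1 _ hK).dotProduct_mulVec_nonneg x
    simp only [LinearEquiv.coe_coe, map_sub, map_smul, e.apply_symm_apply, h4] at h5
    rw [sub_mulVec, smul_mulVec, ← mulVec_mulVec, hx, mulVec_zero, smul_zero, zero_sub,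
      dotProduct_neg, vecMulVec_mulVec, dotProduct_smul] at h5
    have h6 : 0 ≤ star x ⬝ᵥ x := dotProduct_star_self_nonneg x
    have h7 : star x ⬝ᵥ x * (star x ⬝ᵥ x) = 0 :=
      le_antisymm (by simpa using h5) (mul_nonneg h6 h6)
    exact dotProduct_star_self_eq_zero.1 (mul_self_eq_zero.1 h7)
  have hu : IsUnit C := by
    have := (mulVec_injective_iff_isUnit.1 hinj).star
    rwa [star_eq_conjTranspose, conjTranspose_conjTranspose] at this
  exact ⟨hu.unit, hC⟩

theorem eq_conjMap_or_eq_transposeMap_comp_conjMap (h1 : IsPositiveMap e.toLinearMap)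
    (h2 : IsPositiveMap e.symm.toLinearMap) :
    ∃ C : Matrix (Fin n) (Fin n) ℂ, IsUnit C ∧
      (e.toLinearMap = conjMap C ∨ e.toLinearMap = transposeMap n ∘ₗ conjMap C) := by
  obtain ⟨C, hC⟩ := exists_conjMap_single h1 h2
  have hfix : IsDiagonalFixing (e.trans (conjEquiv C).symm) :=
    { pos := fun A hA => isPositiveMap_conjMap (↑C⁻¹ : Matrix (Fin n) (Fin n) ℂ) (e A) (h1 A hA)
      symm_pos := fun A hA => h2 _ (isPositiveMap_conjMap (C : Matrix (Fin n) (Fin n) ℂ) A hA)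
      fix := fun i => (LinearEquiv.symm_apply_eq _).2 (hC i) }
  have hcomp : e.toLinearMap =
      conjMap (C : Matrix _ _ ℂ) ∘ₗ (e.trans (conjEquiv C).symm).toLinearMap := by
    ext1 X
    exact ((conjEquiv C).apply_symm_apply (e X)).symm
  obtain ⟨D, hD, h | h⟩ := hfix.eq_conjMap_or
  · exact ⟨C * D, C.isUnit.mul hD, .inl (by rw [hcomp, h, conjMap_comp])⟩
  · refine ⟨(starRingEnd ℂ).mapMatrix (C : Matrix _ _ ℂ) * D, (C.isUnit.map _).mul hD, .inr ?_⟩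
    rw [hcomp, h, ← LinearMap.comp_assoc, conjMap_comp_transposeMap, LinearMap.comp_assoc,
      conjMap_comp]

end

end MatrixOrdered

theorem mainTheorem7 (n : ℕ)
    (Φ : Matrix (Fin n) (Fin n) ℂ →ₗ[ℂ] Matrix (Fin n) (Fin n) ℂ)
    (hΦ : MatrixOrdered.IsOrderIso Φ) :
    (∃ C : Matrix (Fin n) (Fin n) ℂ, IsUnit C ∧
      (Φ = MatrixOrdered.conjMap C ∨
        Φ = MatrixOrdered.transposeMap n ∘ₗ MatrixOrdered.conjMap C)) ∧
    ((∃ C : Matrix (Fin n) (Fin n) ℂ, IsUnit C ∧ Φ = MatrixOrdered.conjMap C) →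
      MatrixOrdered.IsCompleteOrderIso Φ) ∧
    ((∃ C : Matrix (Fin n) (Fin n) ℂ, IsUnit C ∧
        Φ = MatrixOrdered.transposeMap n ∘ₗ MatrixOrdered.conjMap C) →
      MatrixOrdered.IsCopositiveOrderIso Φ) ∧
    (1 < n →
      ¬ ((∃ C : Matrix (Fin n) (Fin n) ℂ, IsUnit C ∧ Φ = MatrixOrdered.conjMap C) ∧
        (∃ C : Matrix (Fin n) (Fin n) ℂ, IsUnit C ∧
          Φ = MatrixOrdered.transposeMap n ∘ₗ MatrixOrdered.conjMap C))) := by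
  refine ⟨?_, ?_, ?_, ?_⟩
  · obtain ⟨e, rfl, h1, h2⟩ := hΦ
    exact MatrixOrdered.eq_conjMap_or_eq_transposeMap_comp_conjMap h1 h2
  · rintro ⟨_, ⟨C, rfl⟩, rfl⟩
    exact MatrixOrdered.isCompleteOrderIso_conjMap C
  · rintro ⟨_, ⟨C, rfl⟩, rfl⟩
    rw [MatrixOrdered.IsCopositiveOrderIso, MatrixOrdered.transposeMap_comp_transposeMap_comp]
    exact MatrixOrdered.isCompleteOrderIso_conjMap C
  · rintro hn ⟨⟨C, -, h⟩, ⟨_, ⟨D, rfl⟩, h'⟩⟩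
    exact MatrixOrdered.conjMap_ne_transposeMap_comp_conjMap hn C D (h.symm.trans h')
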